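/- Consider problems indexed by $r=1,2,\dots$. In the $r$-th problem there are $\mathcal C_r\ge 1$ possible messages, a set $\Lambda_r\subseteq\{1,\dots,\mathcal C_r\}$ of $K_r$ transmitted messages with $0/1$ indicator vector $s\in\{0,1\}^{\mathcal C_r}$, a code length $n_r$ and a power $Q_r>0$ (for instance a constant $Q_r=Q$). The measurements are $y=Xs+z$, where $X\in\mathbb R^{n_r\times\mathcal C_r}$ has i.i.d. $N(0,Q_r)$ entries (variance $Q_r$) and $z\sim N(0,I_{n_r})$ is independent of $X$; the correlations are $g=X^{T}y$. For a threshold $\lambda\in\mathbb R$ let $P_\lambda$ (resp. $Q_\lambda$) be the number of $i\in\Lambda_r$ (resp. $i\notin\Lambda_r$) with $g_i/(n_rQ_r)>\lambda$, divided by $\mathcal C_r$. Suppose that, as $r\to\infty$, $$n_r\to\infty,\qquad \frac{K_r}{\mathcal C_r}\to\delta,\qquad \frac{K_r+1/Q_r}{n_r}\to\rho\in(0,\infty).$$ Let $\Phi$ be the distribution function of the standard normal distribution. (1) For every $\lambda\in\mathbb R$, $$\mathbb E P_\lambda\to\delta\left[1-\Phi\left(\frac{\lambda-1}{\sqrt\rho}\right)\right],\qquad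 \mathbb E Q_\lambda\to(1-\delta)\left[1-\Phi\left(\frac{\lambda}{\sqrt\rho}\right)\right].$$ (2) (Phase transition of One Step Thresholding.) There is a function $c(\delta,\varepsilon)>0$ of $\delta>0$ and $\varepsilon>0$ with $\delta+\varepsilon<1$, depending on nothing else, such that for every sequence of problems as above with limits $\delta$ and $\rho$ the following hold. There is a $\lambda$ with $$\lim_{r\to\infty}\mathbb E P_\lambda=(1-\varepsilon)\delta,\qquad \lim_{r\to\infty}\mathbb E(P_\lambda+Q_\lambda)=\delta$$ if and only if $(K_r+1/Q_r)/n_r\to c(\delta,\varepsilon)$. Moreover there is exactly one $\lambda$ with $\lim_r\mathbb E(P_\lambda+Q_\lambda)=\delta$, and for this $\lambda$ one has $\lim_r\mathbb E P_\lambda=(1-p)\delta$, where the limiting fraction $p$ of transmitted messages that are missed satisfies $p<\varepsilon$, $p=\varepsilon$ or $p>\varepsilon$ according as $\rho<c(\delta,\varepsilon)$, $\rho=c(\delta,\varepsilon)$ or $\rho>c(\delta,\varepsilon)$. -/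

import Mathlib

open MeasureTheory ProbabilityTheory Filter Topology
open scoped NNReal Matrix

namespace OST

noncomputable section

/-- Outcomes: the entries of the `n × C` codebook matrix `X`, and the noise vector `z ∈ ℝⁿ`. -/
abbrev Outcome (n C : ℕ) : Type := (Fin n → Fin C → ℝ) × (Fin n → ℝ)

/-- The joint law of `(X, z)`: the entries of `X` are i.i.d. `N(0, Q)` (variance `Q`), the entries
of `z` are i.i.d. `N(0, 1)`, and `X` and `z` are independent. -/
def channelLaw (n C : ℕ) (Q : ℝ≥0) : Measure (Outcome n C) :=
  (Measure.pi fun _ : Fin n => Measure.pi fun _ : Fin C => gaussianReal 0 Q).prod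
    (Measure.pi fun _ : Fin n => gaussianReal 0 1)

variable {n C : ℕ}

/-- The codebook matrix `X`; its columns are the codewords. -/
def codebook (ω : Outcome n C) : Matrix (Fin n) (Fin C) ℝ := Matrix.of ω.1

/-- The noise `z`. -/
def noise (ω : Outcome n C) : Fin n → ℝ := ω.2

/-- The activity pattern `s ∈ {0,1}^C` of a set `Λ` of transmitted messages. -/
def activity (Λ : Finset (Fin C)) : Fin C → ℝ := fun i => if i ∈ Λ then 1 else 0

/-- The measurements `y = X s + z`. -/
def received (Λ : Finset (Fin C)) (ω : Outcome n C) : Fin n → ℝ :=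
  codebook ω *ᵥ activity Λ + noise ω

/-- The vector of correlations `g = Xᵀ y`. -/
def correlation (Λ : Finset (Fin C)) (ω : Outcome n C) : Fin C → ℝ :=
  (codebook ω)ᵀ *ᵥ received Λ ω

/-- `P_t`: the number of transmitted messages `i ∈ Λ` whose normalized correlation `g_i / (n Q)`
is above the threshold `t`, divided by `C`. -/
def fracTransmitted (Q : ℝ≥0) (Λ : Finset (Fin C)) (t : ℝ) (ω : Outcome n C) : ℝ :=
  ((Λ.filter fun i => t < correlation Λ ω i / (n * Q)).card : ℝ) / C

/-- `Q_t`: the number of non-transmitted messages `i ∉ Λ` whose normalized correlation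
`g_i / (n Q)` is above the threshold `t`, divided by `C`. -/
def fracNontransmitted (Q : ℝ≥0) (Λ : Finset (Fin C)) (t : ℝ) (ω : Outcome n C) : ℝ :=
  ((Λᶜ.filter fun i => t < correlation Λ ω i / (n * Q)).card : ℝ) / C

/-- The distribution function of the standard normal distribution. -/
def Phi (x : ℝ) : ℝ := cdf (gaussianReal 0 1) x

/-- A sequence of problems: in the `r`-th one there are `C r` possible messages, the set of
transmitted messages is `Λ r` (so `K r` is its cardinality), the code length is `n r` and the power
is `Q r`. The problem size grows with `K / C → δ` and `(K + 1 / Q) / n → ρ`. -/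
structure IsRegime (n C : ℕ → ℕ) (Q : ℕ → ℝ≥0) (Λ : ∀ r, Finset (Fin (C r))) (δ ρ : ℝ) :
    Prop where
  messages_pos : ∀ r, 0 < C r
  power_pos : ∀ r, 0 < Q r
  length_tendsto : Tendsto n atTop atTop
  density_tendsto : Tendsto (fun r => ((Λ r).card : ℝ) / C r) atTop (𝓝 δ)
  load_tendsto : Tendsto (fun r => (((Λ r).card : ℝ) + 1 / (Q r : ℝ)) / n r) atTop (𝓝 ρ)

end

end OST

/-! Fix a message `i` and let `S` be the set of the other transmitted messages. The codeword of `i`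
is independent of the signal received from `S`, whose entries are i.i.d. `N(0, |S| Q + 1)`. Hence,
given the codeword, `g_i / (n Q)` is exactly Gaussian with mean `s_i U` and variance `b U`, where
`b = (|S| + 1 / Q) / n → ρ` and `U` is the mean square of `n` standard normal variables. As `U → 1`
almost surely, dominated convergence gives `ℙ(g_i / (n Q) > t) → 1 - Φ((t - s_i) / √ρ)`, and the
expected fractions are averages of these probabilities.

For the phase transition write `u = (t - 1) / √ρ` and `v = t / √ρ`. The accepted fraction is `δ`
when `δ Φ(u) + (1 - δ) Φ(v) = 1 - δ`, an equation also satisfied by the quantiles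
`a = Φ⁻¹(ε)` and `b = Φ⁻¹(1 - δ ε / (1 - δ))`. Since `Φ` is increasing, `u < a` is equivalent to
`v > b`, hence to `1 / √ρ = v - u > b - a`, and the critical load is `(b - a)⁻²`.
-/

namespace OST

noncomputable section

theorem tendsto_nhds_iff_eq {α X : Type*} [TopologicalSpace X] [T2Space X] {l : Filter α}
    [l.NeBot] {f : α → X} {a b : X} (hf : Tendsto f l (𝓝 a)) : Tendsto f l (𝓝 b) ↔ a = b :=
  ⟨tendsto_nhds_unique hf, fun h => h ▸ hf⟩

theorem measureReal_prod_eq_integral {α β : Type*} [MeasurableSpace α] [MeasurableSpace β]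
    (μ : Measure α) [IsFiniteMeasure μ] (ν : Measure β) [IsFiniteMeasure ν] {s : Set (α × β)}
    (hs : MeasurableSet s) : (μ.prod ν).real s = ∫ x, ν.real (Prod.mk x ⁻¹' s) ∂μ := by
  rw [measureReal_def, Measure.prod_apply hs]
  exact (integral_toReal (measurable_measure_prodMk_left hs).aemeasurable
    (ae_of_all _ fun _ => measure_lt_top _ _)).symm

section ExpectedCount

variable {ι Ω : Type*} {p : ι → Ω → Prop} [∀ ω, DecidablePred (p · ω)]

theorem card_filter_eq_sum_indicator (s : Finset ι) (ω : Ω) :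
    ((s.filter (p · ω)).card : ℝ) = ∑ i ∈ s, {ω | p i ω}.indicator 1 ω := by
  simp [Set.indicator_apply]

variable [MeasurableSpace Ω]

theorem integrable_card_filter (hp : ∀ i, MeasurableSet {ω | p i ω}) (μ : Measure Ω)
    [IsFiniteMeasure μ] (s : Finset ι) :
    Integrable (fun ω => ((s.filter (p · ω)).card : ℝ)) μ := by
  simp only [card_filter_eq_sum_indicator]
  exact integrable_finsetSum _ fun i _ => (integrable_const 1).indicator (hp i)

theorem integral_card_filter (hp : ∀ i, MeasurableSet {ω | p i ω}) (μ : Measure Ω)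
    [IsFiniteMeasure μ] (s : Finset ι) :
    ∫ ω, ((s.filter (p · ω)).card : ℝ) ∂μ = ∑ i ∈ s, μ.real {ω | p i ω} := by
  simp only [card_filter_eq_sum_indicator]
  rw [integral_finsetSum _ fun i _ => (integrable_const 1).indicator (hp i)]
  exact Finset.sum_congr rfl fun i _ => integral_indicator_one (hp i)

end ExpectedCount

theorem iIndepFun_eval_pi {ι : Type*} [Fintype ι] {E : ι → Type*} [∀ i, MeasurableSpace (E i)]
    (μ : ∀ i, Measure (E i)) [∀ i, IsProbabilityMeasure (μ i)] :
    iIndepFun (fun i (x : ∀ i, E i) => x i) (Measure.pi μ) :=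
  iIndepFun_pi (X := fun _ => id) fun _ => aemeasurable_id

theorem continuous_cdf (μ : Measure ℝ) [IsProbabilityMeasure μ] [NullSingletonClass μ] :
    Continuous (cdf μ) := by
  refine continuous_iff_continuousAt.2 fun x => ?_
  rw [(monotone_cdf μ).continuousAt_iff_leftLim_eq_rightLim, StieltjesFunction.rightLim_eq]
  have hjump : ENNReal.ofReal (cdf μ x - Function.leftLim (cdf μ) x) = 0 := by
    rw [← (cdf μ).measure_singleton, measure_cdf, measure_singleton]
  exact ((monotone_cdf μ).leftLim_le le_rfl).antisymm
    (sub_nonpos.1 (ENNReal.ofReal_eq_zero.1 hjump))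

theorem strictMono_cdf (μ : Measure ℝ) [IsProbabilityMeasure μ] [μ.IsOpenPosMeasure] :
    StrictMono (cdf μ) := by
  intro x y hxy
  have hpos : 0 < μ.real (Set.Ioo x y) :=
    ENNReal.toReal_pos (isOpen_Ioo.measure_pos μ (Set.nonempty_Ioo.2 hxy)).ne' (measure_ne_top _ _)
  have hdisj : Disjoint (Set.Iic x) (Set.Ioo x y) :=
    Set.disjoint_left.2 fun z hz hz' => hz'.1.not_ge hz
  calc cdf μ x < μ.real (Set.Iic x) + μ.real (Set.Ioo x y) := by
        rw [cdf_eq_real]; exact lt_add_of_pos_right _ hpos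
    _ = μ.real (Set.Iic x ∪ Set.Ioo x y) := (measureReal_union hdisj measurableSet_Ioo).symm
    _ ≤ cdf μ y := by
        rw [cdf_eq_real, Set.Iic_union_Ioo_eq_Iio hxy]
        exact measureReal_mono Set.Iio_subset_Iic_self

theorem continuous_Phi : Continuous Phi :=
  have := nullSingletonClass_gaussianReal (μ := 0) one_ne_zero
  continuous_cdf (gaussianReal 0 1)

theorem strictMono_Phi : StrictMono Phi :=
  have := (gaussianReal_absolutelyContinuous' 0 one_ne_zero).isOpenPosMeasure
  strictMono_cdf (gaussianReal 0 1)

theorem tendsto_Phi_atBot : Tendsto Phi atBot (𝓝 0) := tendsto_cdf_atBot _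

theorem tendsto_Phi_atTop : Tendsto Phi atTop (𝓝 1) := tendsto_cdf_atTop _

theorem gaussianReal_real_Ioi (m : ℝ) {v : ℝ≥0} (hv : v ≠ 0) (t : ℝ) :
    (gaussianReal m v).real (Set.Ioi t) = 1 - Phi ((t - m) / √v) := by
  have hs : 0 < √(v : ℝ) := Real.sqrt_pos.2 (NNReal.coe_pos.2 hv.bot_lt)
  have hlaw : HasLaw (fun x => (x - m) / √v) (gaussianReal 0 1) (gaussianReal m v) := by
    convert! gaussianReal_div_const (gaussianReal_sub_const HasLaw.id m) √v using 2
    · simp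
    · ext
      simp [Real.sq_sqrt, hv]
  rw [Phi, cdf_eq_real, ← probReal_compl_eq_one_sub measurableSet_Iic, Set.compl_Iic]
  refine Eq.trans ?_ (hlaw.measureReal_eq (p := fun z => (t - m) / √v < z) measurableSet_Ioi)
  congr 1
  ext x
  simp only [Set.mem_Ioi, Set.mem_ofPred_eq, div_lt_div_iff_of_pos_right hs, sub_lt_sub_iff_right]

theorem tendsto_gaussianReal_real_Ioi {α : Type*} {l : Filter α} {m : α → ℝ} {v : α → ℝ≥0}
    {m₀ : ℝ} {v₀ : ℝ≥0} (hm : Tendsto m l (𝓝 m₀)) (hv : Tendsto v l (𝓝 v₀)) (hv₀ : v₀ ≠ 0)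
    (t : ℝ) :
    Tendsto (fun x => (gaussianReal (m x) (v x)).real (Set.Ioi t)) l
      (𝓝 (1 - Phi ((t - m₀) / √v₀))) := by
  have hsqrt : Tendsto (fun x => √(v x : ℝ)) l (𝓝 √v₀) := (NNReal.tendsto_coe.2 hv).sqrt
  have harg := (hm.const_sub t).div hsqrt (Real.sqrt_ne_zero'.2 (NNReal.coe_pos.2 hv₀.bot_lt))
  refine (((continuous_Phi.tendsto _).comp harg).const_sub 1).congr' ?_
  filter_upwards [hv.eventually_ne hv₀] with x hx
  exact (gaussianReal_real_Ioi _ hx t).symm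

theorem hasLaw_sum_gaussianReal {ι Ω : Type*} {mΩ : MeasurableSpace Ω} {P : Measure Ω}
    {X : ι → Ω → ℝ} {m : ι → ℝ} {v : ι → ℝ≥0} (hindep : iIndepFun X P)
    (hX : ∀ i, HasLaw (X i) (gaussianReal (m i) (v i)) P) (s : Finset ι) :
    HasLaw (fun ω => ∑ i ∈ s, X i ω) (gaussianReal (∑ i ∈ s, m i) (∑ i ∈ s, v i)) P where
  aemeasurable := Finset.aemeasurable_fun_sum _ fun i _ => (hX i).aemeasurable
  map_eq := by
    have := hindep.isProbabilityMeasure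
    have : IsProbabilityMeasure (P.map fun ω => ∑ i ∈ s, X i ω) :=
      Measure.isProbabilityMeasure_map
        (Finset.aemeasurable_fun_sum _ fun i _ => (hX i).aemeasurable)
    refine Measure.ext_of_charFun ?_
    ext ξ
    rw [(hindep.restrict _).charFun_map_fun_finsetSum_eq_prod fun i _ => (hX i).aemeasurable]
    simp only [Finset.prod_apply, (hX _).map_eq, charFun_gaussianReal, ← Complex.exp_sum]
    congr 1
    push_cast
    simp only [Finset.mul_sum, Finset.sum_mul, Finset.sum_div, Finset.sum_sub_distrib]

theorem measurePreserving_eval_sum_pi_gaussianReal {ι : Type*} [Fintype ι] (m : ι → ℝ)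
    (v : ι → ℝ≥0) {i : ι} {S : Finset ι} (hi : i ∉ S) :
    MeasurePreserving (fun x : ι → ℝ => (x i, ∑ j ∈ S, x j))
      (Measure.pi fun j => gaussianReal (m j) (v j))
      ((gaussianReal (m i) (v i)).prod (gaussianReal (∑ j ∈ S, m j) (∑ j ∈ S, v j))) := by
  have hindep := iIndepFun_eval_pi fun j => gaussianReal (m j) (v j)
  have heval (j : ι) := (measurePreserving_eval (fun j => gaussianReal (m j) (v j)) j).hasLaw
  refine ⟨by fun_prop, ?_⟩
  have hpair := (hindep.indepFun_finsetSum_of_notMem (fun _ => by fun_prop) hi).symm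
  simp only [Finset.sum_fn] at hpair
  rw [(indepFun_iff_map_prod_eq_prod_map_map (heval i).aemeasurable (by fun_prop)).1 hpair,
    (heval i).map_eq, (hasLaw_sum_gaussianReal hindep heval S).map_eq]

theorem measurePreserving_add_gaussianReal (m₁ m₂ : ℝ) (v₁ v₂ : ℝ≥0) :
    MeasurePreserving (fun p : ℝ × ℝ => p.1 + p.2)
      ((gaussianReal m₁ v₁).prod (gaussianReal m₂ v₂)) (gaussianReal (m₁ + m₂) (v₁ + v₂)) :=
  ⟨by fun_prop, gaussianReal_conv_gaussianReal⟩

theorem hasLaw_sum_mul_gaussianReal {ι : Type*} [Fintype ι] (c : ι → ℝ) (v : ℝ≥0) :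
    HasLaw (fun y : ι → ℝ => ∑ k, c k * y k) (gaussianReal 0 ((∑ k, ‖c k‖₊ ^ 2) * v))
      (Measure.pi fun _ => gaussianReal 0 v) := by
  have hterm (k : ι) : HasLaw (fun y : ι → ℝ => c k * y k) (gaussianReal 0 (‖c k‖₊ ^ 2 * v))
      (Measure.pi fun _ => gaussianReal 0 v) := by
    convert! gaussianReal_const_mul
      (measurePreserving_eval (fun _ : ι => gaussianReal 0 v) k).hasLaw (c k) using 2
    · simp
    · ext; simp
  have hindep : iIndepFun (fun k (y : ι → ℝ) => c k * y k) (Measure.pi fun _ => gaussianReal 0 v) :=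
    iIndepFun_pi (X := fun k y => c k * y) fun _ => by fun_prop
  simpa [Finset.sum_mul] using hasLaw_sum_gaussianReal hindep hterm Finset.univ

section Received

variable {n C : ℕ}

theorem received_apply (Λ : Finset (Fin C)) (ω : Outcome n C) (k : Fin n) :
    received Λ ω k = ∑ j ∈ Λ, ω.1 k j + ω.2 k := by
  simp [received, codebook, noise, activity, Matrix.mulVec, dotProduct]

theorem correlation_apply (Λ : Finset (Fin C)) (ω : Outcome n C) (i : Fin C) :
    correlation Λ ω i = ∑ k, ω.1 k i * received Λ ω k := by
  simp [correlation, codebook, Matrix.mulVec, dotProduct]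

theorem received_eq_add_received_erase (Λ : Finset (Fin C)) (i : Fin C) (ω : Outcome n C)
    (k : Fin n) :
    received Λ ω k = activity Λ i * ω.1 k i + received (Λ.erase i) ω k := by
  by_cases hi : i ∈ Λ
  · rw [received_apply, received_apply, ← Finset.add_sum_erase Λ _ hi, activity, if_pos hi, one_mul,
      add_assoc]
  · simp [activity, hi]

theorem measurePreserving_codeword_received (n : ℕ) (Q : ℝ≥0) {S : Finset (Fin C)} {i : Fin C}
    (hi : i ∉ S) :
    MeasurePreserving (fun ω : Outcome n C => (fun k => ω.1 k i, received S ω)) (channelLaw n C Q)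
      ((Measure.pi fun _ => gaussianReal 0 Q).prod
        (Measure.pi fun _ => gaussianReal 0 (S.card * Q + 1))) := by
  have hrow : MeasurePreserving (fun p : (Fin C → ℝ) × ℝ => (p.1 i, ∑ j ∈ S, p.1 j + p.2))
      ((Measure.pi fun _ => gaussianReal 0 Q).prod (gaussianReal 0 1))
      ((gaussianReal 0 Q).prod (gaussianReal 0 (S.card * Q + 1))) := by
    have hsplit := measurePreserving_eval_sum_pi_gaussianReal (fun _ => 0) (fun _ => Q) hi
    have hadd := measurePreserving_add_gaussianReal 0 0 (S.card * Q) 1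
    simp only [Finset.sum_const_zero, Finset.sum_const, nsmul_eq_mul] at hsplit
    rw [add_zero] at hadd
    exact ((MeasurePreserving.id _).prod hadd).comp <| (measurePreserving_prodAssoc ..).comp <|
      hsplit.prod (.id _)
  have hrows := (measurePreserving_pi _ _ fun _ : Fin n => hrow).comp
    (measurePreserving_arrowProdEquivProdArrow (Fin C → ℝ) ℝ (Fin n) _ _).symm
  have hreceived : received S = fun (ω : Outcome n C) k => ∑ j ∈ S, ω.1 k j + ω.2 k :=
    funext fun ω => funext (received_apply S ω)
  rw [hreceived, channelLaw]
  exact (measurePreserving_arrowProdEquivProdArrow ℝ ℝ (Fin n) _ _).comp hrows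

end Received

theorem hasLaw_sum_mul_add_div_gaussianReal {ι : Type*} [Fintype ι] (x : ι → ℝ) (a : ℝ)
    (v d : ℝ≥0) :
    HasLaw (fun y : ι → ℝ => (∑ k, x k * (a * x k + y k)) / d)
      (gaussianReal (a * (∑ k, x k ^ 2) / d) ((∑ k, ‖x k‖₊ ^ 2) * v / d ^ 2))
      (Measure.pi fun _ => gaussianReal 0 v) := by
  convert! gaussianReal_div_const (gaussianReal_const_add (hasLaw_sum_mul_gaussianReal x v)
    (a * ∑ k, x k ^ 2)) d using 2 with y
  · rw [Finset.mul_sum, ← Finset.sum_add_distrib]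
    congr 1
    exact Finset.sum_congr rfl fun k _ => by ring
  · rw [zero_add]

/-- The law of an infinite sequence of independent standard normal variables. All code lengths `n`
use the initial segments of one such sequence, so that the strong law of large numbers applies. -/
def gaussianSeq : Measure (ℕ → ℝ) := Measure.infinitePi fun _ => gaussianReal 0 1

instance : IsProbabilityMeasure gaussianSeq := by unfold gaussianSeq; infer_instance

theorem measurePreserving_const_mul_gaussianSeq (n : ℕ) (v : ℝ≥0) :
    MeasurePreserving (fun w (k : Fin n) => √v * w k) gaussianSeq
      (Measure.pi fun _ => gaussianReal 0 v) := by
  have hsegment : MeasurePreserving (fun w (k : Fin n) => w k) gaussianSeq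
      (Measure.pi fun _ => gaussianReal 0 1) :=
    ⟨by fun_prop, by
      rw [gaussianSeq, Measure.map_infinitePi_infinitePi_of_inj Fin.val_injective,
        Measure.infinitePi_eq_pi]⟩
  have hscale : MeasurePreserving (√(v : ℝ) * ·) (gaussianReal 0 1) (gaussianReal 0 v) :=
    ⟨by fun_prop, by
      rw [gaussianReal_map_const_mul]
      congr 1
      · simp
      · ext; simp⟩
  exact (measurePreserving_pi _ _ fun _ => hscale).comp hsegment

/-- The mean of the squares of the first `n` terms of a sequence. It takes values in `ℝ≥0` since it
rescales variances. -/
def meanSq (n : ℕ) (w : ℕ → ℝ) : ℝ≥0 := (∑ k ∈ Finset.range n, ‖w k‖₊ ^ 2) / n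

/-- The probability that the normalized correlation of a message exceeds `t`, as the average of its
conditional probability given the codeword. Here `a` is the activity of the message and `b` is the
load caused by the other messages and the noise. -/
def exceedProb (a : ℝ) (b : ℝ≥0) (n : ℕ) (t : ℝ) : ℝ :=
  ∫ w, (gaussianReal (a * meanSq n w) (b * meanSq n w)).real (Set.Ioi t) ∂gaussianSeq

theorem hasLaw_correlation_given_codeword {Q : ℝ≥0} (hQ : 0 < Q) (n : ℕ) (w : ℕ → ℝ) (a : ℝ)
    (c : ℝ≥0) :
    HasLaw (fun y : Fin n → ℝ => (∑ k : Fin n, √Q * w k * (a * (√Q * w k) + y k)) / (n * Q))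
      (gaussianReal (a * meanSq n w) ((c + 1 / Q) / n * meanSq n w))
      (Measure.pi fun _ => gaussianReal 0 (c * Q + 1)) := by
  have henergy : ∑ k : Fin n, ‖√Q * w k‖₊ ^ 2 = n * Q * meanSq n w := by
    rcases eq_or_ne n 0 with rfl | hn
    · simp
    · have hsqrt : ‖√(Q : ℝ)‖₊ ^ 2 = Q := by ext; simp
      simp only [nnnorm_mul, mul_pow, hsqrt, ← Finset.mul_sum]
      rw [meanSq, Fin.sum_univ_eq_sum_range (fun k => ‖w k‖₊ ^ 2)]
      field
  have henergy' : ∑ k : Fin n, (√Q * w k) ^ 2 = n * Q * meanSq n w := by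
    simpa [mul_pow] using congrArg ((↑) : ℝ≥0 → ℝ) henergy
  convert! hasLaw_sum_mul_add_div_gaussianReal (fun k : Fin n => √Q * w k) a (c * Q + 1) (n * Q)
    using 2
  · rw [henergy']
    rcases eq_or_ne n 0 with rfl | hn
    · simp [meanSq]
    · push_cast
      have : (Q : ℝ) ≠ 0 := NNReal.coe_ne_zero.2 hQ.ne'
      field
  · rw [henergy]
    rcases eq_or_ne n 0 with rfl | hn
    · simp
    · have := hQ.ne'
      field

theorem channelLaw_real_lt_correlation {n C : ℕ} {Q : ℝ≥0} (hQ : 0 < Q) (Λ : Finset (Fin C))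
    (i : Fin C) (t : ℝ) :
    (channelLaw n C Q).real {ω | t < correlation Λ ω i / (n * Q)} =
      exceedProb (activity Λ i) (((Λ.erase i).card + 1 / Q) / n) n t := by
  let a := activity Λ i
  let μ : Measure (Fin n → ℝ) := .pi fun _ => gaussianReal 0 ((Λ.erase i).card * Q + 1)
  let A : Set ((Fin n → ℝ) × (Fin n → ℝ)) :=
    {p | t < (∑ k, p.1 k * (a * p.1 k + p.2 k)) / (n * Q)}
  have hA : MeasurableSet A := measurableSet_lt (by fun_prop) (by fun_prop)
  have hcodeword := measurePreserving_codeword_received n Q (Λ.notMem_erase i)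
  have hscale := (measurePreserving_const_mul_gaussianSeq n Q).prod (.id μ)
  calc (channelLaw n C Q).real {ω | t < correlation Λ ω i / (n * Q)}
      = ((Measure.pi fun _ => gaussianReal 0 Q).prod μ).real A := by
        rw [← hcodeword.hasLaw.measureReal_eq hA]
        simp only [correlation_apply, received_eq_add_received_erase Λ i, a]
    _ = (gaussianSeq.prod μ).real (Prod.map (fun w (k : Fin n) => √Q * w k) id ⁻¹' A) :=
        (hscale.hasLaw.measureReal_eq hA).symm
    _ = exceedProb a (((Λ.erase i).card + 1 / Q) / n) n t := by
        rw [measureReal_prod_eq_integral _ _ (hscale.measurable hA)]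
        exact integral_congr_ae (ae_of_all _ fun w =>
          (hasLaw_correlation_given_codeword hQ n w a _).measureReal_eq measurableSet_Ioi)

theorem integral_sq_gaussianReal (m : ℝ) (v : ℝ≥0) :
    ∫ x, x ^ 2 ∂(gaussianReal m v) = v + m ^ 2 := by
  have hvar := variance_eq_sub (memLp_id_gaussianReal (μ := m) (v := v) 2)
  simp only [variance_id_gaussianReal, Pi.pow_apply, id_eq, integral_id_gaussianReal] at hvar
  exact sub_eq_iff_eq_add.1 hvar.symm

theorem ae_tendsto_meanSq : ∀ᵐ w ∂gaussianSeq, Tendsto (meanSq · w) atTop (𝓝 1) := by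
  have heval (k : ℕ) : MeasurePreserving (fun w => w k) gaussianSeq (gaussianReal 0 1) :=
    measurePreserving_eval_infinitePi _ k
  have hindep : iIndepFun (fun (k : ℕ) (w : ℕ → ℝ) => w k ^ 2) gaussianSeq :=
    iIndepFun_infinitePi (X := fun _ x => x ^ 2) fun _ => by fun_prop
  have hint : Integrable (fun w : ℕ → ℝ => w 0 ^ 2) gaussianSeq :=
    (heval 0).integrable_comp_of_integrable (memLp_id_gaussianReal 2).integrable_sq
  have hmean : ∫ w : ℕ → ℝ, w 0 ^ 2 ∂gaussianSeq = 1 := by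
    refine ((heval 0).hasLaw.integral_comp (f := (· ^ 2)) (by fun_prop)).trans ?_
    simp [integral_sq_gaussianReal]
  have hlln := strong_law_ae_real (fun (k : ℕ) (w : ℕ → ℝ) => w k ^ 2) hint
    (fun i j hij => hindep.indepFun hij)
    fun k => ((heval k).hasLaw.identDistrib (heval 0).hasLaw).comp (measurable_id.pow_const 2)
  rw [hmean] at hlln
  filter_upwards [hlln] with w hw
  rw [← NNReal.tendsto_coe]
  simpa [meanSq] using hw

theorem measurable_meanSq (n : ℕ) : Measurable (meanSq n) := by
  unfold meanSq
  fun_prop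

theorem measurable_gaussianReal_real {s : Set ℝ} (hs : MeasurableSet s) :
    Measurable fun p : ℝ × ℝ≥0 => (gaussianReal p.1 p.2).real s :=
  ((Measure.measurable_coe hs).comp measurable_gaussianReal).ennreal_toReal

theorem tendsto_exceedProb {α : Type*} {l : Filter α} [l.IsCountablyGenerated] {n : α → ℕ}
    (hn : Tendsto n l atTop) {b : α → ℝ≥0} {ρ : ℝ} (hρ : 0 < ρ)
    (hb : Tendsto (fun r => (b r : ℝ)) l (𝓝 ρ)) (a t : ℝ) :
    Tendsto (fun r => exceedProb a (b r) (n r) t) l (𝓝 (1 - Phi ((t - a) / √ρ))) := by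
  lift ρ to ℝ≥0 using hρ.le
  have hmeas (r : α) : Measurable fun w =>
      (gaussianReal (a * meanSq (n r) w) (b r * meanSq (n r) w)).real (Set.Ioi t) := by
    have hU := measurable_meanSq (n r)
    exact (measurable_gaussianReal_real measurableSet_Ioi).comp
      (f := fun w => (a * (meanSq (n r) w : ℝ), b r * meanSq (n r) w)) (by fun_prop)
  have hlim : ∀ᵐ w ∂gaussianSeq, Tendsto (fun r =>
      (gaussianReal (a * meanSq (n r) w) (b r * meanSq (n r) w)).real (Set.Ioi t)) l
      (𝓝 (1 - Phi ((t - a) / √ρ))) := by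
    filter_upwards [ae_tendsto_meanSq] with w hw
    have hU := hw.comp hn
    simpa using tendsto_gaussianReal_real_Ioi ((NNReal.tendsto_coe.2 hU).const_mul a)
      ((NNReal.tendsto_coe.1 hb).mul hU)
      (by simpa using (NNReal.coe_pos.1 hρ).ne') t
  have hdom := tendsto_integral_filter_of_dominated_convergence (fun _ => 1)
    (.of_forall fun r => (hmeas r).aestronglyMeasurable)
    (.of_forall fun r => ae_of_all _ fun w =>
      (Real.norm_of_nonneg measureReal_nonneg).trans_le measureReal_le_one)
    (integrable_const 1) hlim
  simpa [exceedProb] using hdom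

instance (n C : ℕ) (Q : ℝ≥0) : IsProbabilityMeasure (channelLaw n C Q) := by
  unfold channelLaw; infer_instance

section Channel

variable {n C : ℕ} (Q : ℝ≥0) (Λ : Finset (Fin C)) (t : ℝ)

theorem measurableSet_lt_correlation (i : Fin C) :
    MeasurableSet {ω : Outcome n C | t < correlation Λ ω i / (n * Q)} := by
  simp only [correlation_apply, received_apply]
  exact measurableSet_lt (by fun_prop) (by fun_prop)

theorem integrable_fracTransmitted :
    Integrable (fracTransmitted Q Λ t) (channelLaw n C Q) :=
  (integrable_card_filter (measurableSet_lt_correlation Q Λ t) _ Λ).div_const _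

theorem integrable_fracNontransmitted :
    Integrable (fracNontransmitted Q Λ t) (channelLaw n C Q) :=
  (integrable_card_filter (measurableSet_lt_correlation Q Λ t) _ Λᶜ).div_const _

variable {Q}

theorem integral_fracTransmitted (hQ : 0 < Q) :
    ∫ ω, fracTransmitted Q Λ t ω ∂(channelLaw n C Q) =
      Λ.card / C * exceedProb 1 (((Λ.card - 1 : ℕ) + 1 / Q) / n) n t := by
  have hprob : ∀ i ∈ Λ, (channelLaw n C Q).real {ω | t < correlation Λ ω i / (n * Q)} =
      exceedProb 1 (((Λ.card - 1 : ℕ) + 1 / Q) / n) n t := fun i hi => by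
    rw [channelLaw_real_lt_correlation hQ, Finset.card_erase_of_mem hi, activity, if_pos hi]
  simp only [fracTransmitted]
  rw [integral_div, integral_card_filter (measurableSet_lt_correlation Q Λ t),
    Finset.sum_congr rfl hprob, Finset.sum_const, nsmul_eq_mul, mul_div_right_comm]

theorem integral_fracNontransmitted (hQ : 0 < Q) :
    ∫ ω, fracNontransmitted Q Λ t ω ∂(channelLaw n C Q) =
      Λᶜ.card / C * exceedProb 0 ((Λ.card + 1 / Q) / n) n t := by
  have hprob : ∀ i ∈ Λᶜ, (channelLaw n C Q).real {ω | t < correlation Λ ω i / (n * Q)} =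
      exceedProb 0 ((Λ.card + 1 / Q) / n) n t := fun i hi => by
    have hi' := Finset.mem_compl.1 hi
    rw [channelLaw_real_lt_correlation hQ, Finset.erase_eq_of_notMem hi', activity, if_neg hi']
  simp only [fracNontransmitted]
  rw [integral_div, integral_card_filter (measurableSet_lt_correlation Q Λ t),
    Finset.sum_congr rfl hprob, Finset.sum_const, nsmul_eq_mul, mul_div_right_comm]

end Channel

/-- The limit of the expected fraction of accepted messages at the threshold `t`. -/
def acceptedLimit (δ ρ t : ℝ) : ℝ :=
  δ * (1 - Phi ((t - 1) / √ρ)) + (1 - δ) * (1 - Phi (t / √ρ))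

namespace IsRegime

variable {n C : ℕ → ℕ} {Q : ℕ → ℝ≥0} {Λ : ∀ r, Finset (Fin (C r))} {δ ρ : ℝ}

theorem tendsto_load_pred (h : IsRegime n C Q Λ δ ρ) :
    Tendsto (fun r => (((Λ r).card - 1 : ℕ) + 1 / (Q r : ℝ)) / n r) atTop (𝓝 ρ) := by
  have hinv : Tendsto (fun r => 1 / (n r : ℝ)) atTop (𝓝 0) :=
    tendsto_one_div_atTop_nhds_zero_nat.comp h.length_tendsto
  have hlower := h.load_tendsto.sub hinv
  rw [sub_zero] at hlower
  refine tendsto_of_tendsto_of_tendsto_of_le_of_le hlower h.load_tendsto (fun r => ?_) fun r => ?_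
  · have hcard : ((Λ r).card : ℝ) ≤ ((Λ r).card - 1 : ℕ) + 1 := by
      exact_mod_cast Nat.le_succ_of_pred_le le_rfl
    simp only [← sub_div]
    gcongr
    linarith
  · dsimp only
    gcongr
    exact Nat.sub_le _ _

theorem tendsto_density_compl (h : IsRegime n C Q Λ δ ρ) :
    Tendsto (fun r => ((Λ r)ᶜ.card : ℝ) / C r) atTop (𝓝 (1 - δ)) := by
  refine (h.density_tendsto.const_sub 1).congr fun r => ?_
  have hC : (C r : ℝ) ≠ 0 := Nat.cast_ne_zero.2 (h.messages_pos r).ne'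
  rw [Finset.card_compl, Nat.cast_sub (Finset.card_le_univ _), Fintype.card_fin, sub_div,
    div_self hC]

theorem tendsto_integral_fracTransmitted (h : IsRegime n C Q Λ δ ρ) (hρ : 0 < ρ) (t : ℝ) :
    Tendsto (fun r => ∫ ω, fracTransmitted (Q r) (Λ r) t ω ∂(channelLaw (n r) (C r) (Q r)))
      atTop (𝓝 (δ * (1 - Phi ((t - 1) / √ρ)))) := by
  simp only [integral_fracTransmitted _ _ (h.power_pos _)]
  exact h.density_tendsto.mul
    (tendsto_exceedProb h.length_tendsto hρ (by exact_mod_cast h.tendsto_load_pred) 1 t)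

theorem tendsto_integral_fracNontransmitted (h : IsRegime n C Q Λ δ ρ) (hρ : 0 < ρ) (t : ℝ) :
    Tendsto (fun r => ∫ ω, fracNontransmitted (Q r) (Λ r) t ω ∂(channelLaw (n r) (C r) (Q r)))
      atTop (𝓝 ((1 - δ) * (1 - Phi (t / √ρ)))) := by
  simp only [integral_fracNontransmitted _ _ (h.power_pos _)]
  simpa only [sub_zero] using h.tendsto_density_compl.mul
    (tendsto_exceedProb h.length_tendsto hρ (by exact_mod_cast h.load_tendsto) 0 t)

theorem tendsto_integral_accepted (h : IsRegime n C Q Λ δ ρ) (hρ : 0 < ρ) (t : ℝ) :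
    Tendsto (fun r => ∫ ω, (fracTransmitted (Q r) (Λ r) t ω + fracNontransmitted (Q r) (Λ r) t ω)
      ∂(channelLaw (n r) (C r) (Q r))) atTop (𝓝 (acceptedLimit δ ρ t)) := by
  simp only [integral_add (integrable_fracTransmitted _ _ _) (integrable_fracNontransmitted _ _ _)]
  exact (h.tendsto_integral_fracTransmitted hρ t).add (h.tendsto_integral_fracNontransmitted hρ t)

theorem tendsto_integral_fracTransmitted_iff (h : IsRegime n C Q Λ δ ρ) (hδ : δ ≠ 0) (hρ : 0 < ρ)
    (t p : ℝ) :
    Tendsto (fun r => ∫ ω, fracTransmitted (Q r) (Λ r) t ω ∂(channelLaw (n r) (C r) (Q r)))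
      atTop (𝓝 ((1 - p) * δ)) ↔ Phi ((t - 1) / √ρ) = p := by
  rw [tendsto_nhds_iff_eq (h.tendsto_integral_fracTransmitted hρ t), mul_comm δ,
    mul_left_inj' hδ, sub_right_inj]

theorem tendsto_integral_accepted_iff (h : IsRegime n C Q Λ δ ρ) (hρ : 0 < ρ) (t : ℝ) :
    Tendsto (fun r => ∫ ω, (fracTransmitted (Q r) (Λ r) t ω + fracNontransmitted (Q r) (Λ r) t ω)
      ∂(channelLaw (n r) (C r) (Q r))) atTop (𝓝 δ) ↔ acceptedLimit δ ρ t = δ :=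
  tendsto_nhds_iff_eq (h.tendsto_integral_accepted hρ t)

end IsRegime

/-- The quantile function of the standard normal distribution: the inverse of `Phi` on `(0, 1)`,
with junk values elsewhere. -/
def quantile (q : ℝ) : ℝ := Function.invFun Phi q

theorem Phi_quantile {q : ℝ} (hq₀ : 0 < q) (hq₁ : q < 1) : Phi (quantile q) = q :=
  Function.invFun_eq <| mem_range_of_exists_le_of_exists_ge continuous_Phi
    (tendsto_Phi_atBot.eventually_le_const hq₀).exists
    (tendsto_Phi_atTop.eventually_const_le hq₁).exists

section AcceptedLimit

variable {δ ρ : ℝ}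

theorem strictAnti_acceptedLimit (hδ₀ : 0 < δ) (hδ₁ : δ < 1) (hρ : 0 < ρ) :
    StrictAnti (acceptedLimit δ ρ) := by
  intro x y hxy
  have hmissed : Phi ((x - 1) / √ρ) < Phi ((y - 1) / √ρ) := strictMono_Phi (by gcongr)
  have hrejected : Phi (x / √ρ) < Phi (y / √ρ) := strictMono_Phi (by gcongr)
  have : 0 < 1 - δ := sub_pos.2 hδ₁
  unfold acceptedLimit
  gcongr

theorem continuous_acceptedLimit (δ ρ : ℝ) : Continuous (acceptedLimit δ ρ) := by
  have := continuous_Phi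
  unfold acceptedLimit
  fun_prop

theorem tendsto_acceptedLimit {l : Filter ℝ} {y : ℝ}
    (hmissed : Tendsto (fun t => Phi ((t - 1) / √ρ)) l (𝓝 y))
    (hrejected : Tendsto (fun t => Phi (t / √ρ)) l (𝓝 y)) (δ : ℝ) :
    Tendsto (acceptedLimit δ ρ) l (𝓝 (1 - y)) := by
  have := ((hmissed.const_sub 1).const_mul δ).add ((hrejected.const_sub 1).const_mul (1 - δ))
  rwa [← add_mul, add_sub_cancel, one_mul] at this

theorem tendsto_acceptedLimit_atBot (δ : ℝ) (hρ : 0 < ρ) :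
    Tendsto (acceptedLimit δ ρ) atBot (𝓝 1) := by
  have hs := Real.sqrt_pos.2 hρ
  simpa using tendsto_acceptedLimit
    (tendsto_Phi_atBot.comp ((tendsto_atBot_add_const_right _ (-1) tendsto_id).atBot_div_const hs))
    (tendsto_Phi_atBot.comp (tendsto_id.atBot_div_const hs)) δ

theorem tendsto_acceptedLimit_atTop (δ : ℝ) (hρ : 0 < ρ) :
    Tendsto (acceptedLimit δ ρ) atTop (𝓝 0) := by
  have hs := Real.sqrt_pos.2 hρ
  simpa using tendsto_acceptedLimit
    (tendsto_Phi_atTop.comp ((tendsto_atTop_add_const_right _ (-1) tendsto_id).atTop_div_const hs))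
    (tendsto_Phi_atTop.comp (tendsto_id.atTop_div_const hs)) δ

theorem existsUnique_acceptedLimit_eq (hδ₀ : 0 < δ) (hδ₁ : δ < 1) (hρ : 0 < ρ) :
    ∃! t, acceptedLimit δ ρ t = δ := by
  obtain ⟨t, ht⟩ := mem_range_of_exists_le_of_exists_ge (continuous_acceptedLimit δ ρ)
    ((tendsto_acceptedLimit_atTop δ hρ).eventually_le_const hδ₀).exists
    ((tendsto_acceptedLimit_atBot δ hρ).eventually_const_le hδ₁).exists
  exact ⟨t, ht, fun u hu => (strictAnti_acceptedLimit hδ₀ hδ₁ hρ).injective (hu.trans ht.symm)⟩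

end AcceptedLimit

theorem cmp_eq_cmp_of_weighted_add_eq {α : Type*} [LinearOrder α] {f : α → ℝ} (hf : StrictMono f)
    {p q : ℝ} (hp : 0 < p) (hq : 0 < q) {u v a b : α}
    (h : p * f u + q * f v = p * f a + q * f b) : cmp u a = cmp b v :=
  calc cmp u a = cmp (p * f u) (p * f a) := by rw [cmp_mul_pos_left hp, hf.cmp_map_eq]
    _ = cmp (p * f u - p * f a) 0 := (cmp_sub_zero _ _).symm
    _ = cmp (q * f b - q * f v) 0 := by congr 1; linarith
    _ = cmp (q * f b) (q * f v) := cmp_sub_zero _ _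
    _ = cmp b v := by rw [cmp_mul_pos_left hq, hf.cmp_map_eq]

theorem cmp_sub_sub_eq_of_cmp_eq {α : Type*} [AddCommGroup α] [LinearOrder α]
    [IsOrderedAddMonoid α] {u v a b : α} (h : cmp u a = cmp b v) :
    cmp (b - a) (v - u) = cmp u a := by
  rcases lt_trichotomy u a with hua | rfl | hau
  · have hbv : b < v := (lt_iff_lt_of_cmp_eq_cmp h).1 hua
    rw [hua.cmp_eq_lt, (sub_lt_sub hbv hua).cmp_eq_lt]
  · have hbv : b = v := (eq_iff_eq_of_cmp_eq_cmp h).1 rfl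
    rw [hbv, cmp_self_eq_eq, cmp_self_eq_eq]
  · have hvb : v < b := (lt_iff_lt_of_cmp_eq_cmp (cmp_eq_cmp_symm.1 h)).1 hau
    rw [hau.cmp_eq_gt, (sub_lt_sub hvb hau).cmp_eq_gt]

theorem cmp_one_div_sqrt {x y : ℝ} (hx : 0 < x) (hy : 0 < y) : cmp (1 / √x) (1 / √y) = cmp y x :=
  have hanti : StrictAntiOn (fun z => 1 / √z) (Set.Ioi 0) := fun _ ha _ _ hab =>
    one_div_lt_one_div_of_lt (Real.sqrt_pos.2 ha) (Real.sqrt_lt_sqrt (le_of_lt ha) hab)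
  hanti.cmp_map_eq hx hy

/-- The critical load of one step thresholding. If a fraction `ε` of the transmitted messages is
missed at the threshold `t` and the accepted fraction is `δ`, then a fraction `1 - δε/(1 - δ)` of
the other messages is rejected, so that `(t - 1)/√ρ` and `t/√ρ` are the two quantiles below and
their difference is `1/√ρ`. -/
def criticalLoad (δ ε : ℝ) : ℝ :=
  ((quantile (1 - δ * ε / (1 - δ)) - quantile ε) ^ 2)⁻¹

theorem lt_one_sub_mul_div {δ ε : ℝ} (hε : 0 < ε) (hδε : δ + ε < 1) :
    ε < 1 - δ * ε / (1 - δ) := by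
  rw [lt_sub_comm, div_lt_iff₀ (by linarith)]
  linarith

theorem one_sub_mul_div_lt_one {δ ε : ℝ} (hδ₀ : 0 < δ) (hδ₁ : δ < 1) (hε : 0 < ε) :
    1 - δ * ε / (1 - δ) < 1 :=
  sub_lt_self _ (div_pos (mul_pos hδ₀ hε) (sub_pos.2 hδ₁))

section CriticalLoad

variable {δ ε : ℝ}

theorem Phi_quantile_reject (hδ : 0 < δ) (hε : 0 < ε) (hδε : δ + ε < 1) :
    Phi (quantile (1 - δ * ε / (1 - δ))) = 1 - δ * ε / (1 - δ) :=
  Phi_quantile (hε.trans (lt_one_sub_mul_div hε hδε)) (one_sub_mul_div_lt_one hδ (by linarith) hε)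

theorem quantile_lt_quantile (hδ : 0 < δ) (hε : 0 < ε) (hδε : δ + ε < 1) :
    quantile ε < quantile (1 - δ * ε / (1 - δ)) := by
  rw [← strictMono_Phi.lt_iff_lt, Phi_quantile hε (by linarith), Phi_quantile_reject hδ hε hδε]
  exact lt_one_sub_mul_div hε hδε

theorem criticalLoad_pos (hδ : 0 < δ) (hε : 0 < ε) (hδε : δ + ε < 1) :
    0 < criticalLoad δ ε :=
  inv_pos.2 (pow_pos (sub_pos.2 (quantile_lt_quantile hδ hε hδε)) 2)

theorem one_div_sqrt_criticalLoad (hδ : 0 < δ) (hε : 0 < ε) (hδε : δ + ε < 1) :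
    1 / √(criticalLoad δ ε) = quantile (1 - δ * ε / (1 - δ)) - quantile ε := by
  rw [criticalLoad, Real.sqrt_inv, one_div, inv_inv,
    Real.sqrt_sq (sub_pos.2 (quantile_lt_quantile hδ hε hδε)).le]

theorem cmp_missed_criticalLoad (hδ : 0 < δ) (hε : 0 < ε) (hδε : δ + ε < 1) {ρ t : ℝ}
    (hρ : 0 < ρ) (ht : acceptedLimit δ ρ t = δ) :
    cmp (Phi ((t - 1) / √ρ)) ε = cmp ρ (criticalLoad δ ε) := by
  have hδ' : 0 < 1 - δ := by linarith
  have hquantile : Phi (quantile ε) = ε := Phi_quantile hε (by linarith)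
  have hquantile' := Phi_quantile_reject hδ hε hδε
  have hbalance : δ * Phi ((t - 1) / √ρ) + (1 - δ) * Phi (t / √ρ) =
      δ * Phi (quantile ε) + (1 - δ) * Phi (quantile (1 - δ * ε / (1 - δ))) := by
    rw [hquantile, hquantile', mul_sub, mul_div_cancel₀ _ hδ'.ne']
    unfold acceptedLimit at ht
    linarith
  have hcmp := cmp_eq_cmp_of_weighted_add_eq strictMono_Phi hδ hδ' hbalance
  calc cmp (Phi ((t - 1) / √ρ)) ε
      = cmp ((t - 1) / √ρ) (quantile ε) := by
        rw [← strictMono_Phi.cmp_map_eq _ (quantile ε), hquantile]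
    _ = cmp (quantile (1 - δ * ε / (1 - δ)) - quantile ε) (t / √ρ - (t - 1) / √ρ) :=
        (cmp_sub_sub_eq_of_cmp_eq hcmp).symm
    _ = cmp (1 / √(criticalLoad δ ε)) (1 / √ρ) := by
        rw [one_div_sqrt_criticalLoad hδ hε hδε, ← sub_div, sub_sub_cancel]
    _ = cmp ρ (criticalLoad δ ε) := cmp_one_div_sqrt (criticalLoad_pos hδ hε hδε) hρ

end CriticalLoad

end

end OST

theorem corollary1 :
    -- the limits of `E P_t` and `E Q_t`
    (∀ (n C : ℕ → ℕ) (Q : ℕ → ℝ≥0) (Λ : ∀ r, Finset (Fin (C r))) (δ ρ : ℝ),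
      0 < ρ → OST.IsRegime n C Q Λ δ ρ → ∀ t : ℝ,
        Tendsto (fun r => ∫ ω, OST.fracTransmitted (Q r) (Λ r) t ω
            ∂(OST.channelLaw (n r) (C r) (Q r)))
          atTop (𝓝 (δ * (1 - OST.Phi ((t - 1) / √ρ)))) ∧
        Tendsto (fun r => ∫ ω, OST.fracNontransmitted (Q r) (Λ r) t ω
            ∂(OST.channelLaw (n r) (C r) (Q r)))
          atTop (𝓝 ((1 - δ) * (1 - OST.Phi (t / √ρ))))) ∧
    -- the phase transition
    (∃ c : ℝ → ℝ → ℝ, ∀ δ ε : ℝ, 0 < δ → 0 < ε → δ + ε < 1 →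
      0 < c δ ε ∧
      ∀ (n C : ℕ → ℕ) (Q : ℕ → ℝ≥0) (Λ : ∀ r, Finset (Fin (C r))) (ρ : ℝ),
        0 < ρ → OST.IsRegime n C Q Λ δ ρ →
        -- `E P_t = (1 - ε) δ` and `E (P_t + Q_t) = δ` can be solved, asymptotically, exactly when
        -- `(K + 1 / Q) / n = c(δ, ε)` asymptotically
        ((∃ t : ℝ,
            Tendsto (fun r => ∫ ω, OST.fracTransmitted (Q r) (Λ r) t ω
                ∂(OST.channelLaw (n r) (C r) (Q r)))
              atTop (𝓝 ((1 - ε) * δ)) ∧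
            Tendsto (fun r => ∫ ω, (OST.fracTransmitted (Q r) (Λ r) t ω
                + OST.fracNontransmitted (Q r) (Λ r) t ω) ∂(OST.channelLaw (n r) (C r) (Q r)))
              atTop (𝓝 δ)) ↔
          Tendsto (fun r => (((Λ r).card : ℝ) + 1 / (Q r : ℝ)) / n r) atTop (𝓝 (c δ ε))) ∧
        -- at the unique threshold for which the accepted fraction is `δ`, the limiting fraction `p`
        -- of transmitted messages that are missed is below, at or above `ε` according as
        -- `ρ` is below, at or above `c(δ, ε)`
        (∃! t : ℝ,
            Tendsto (fun r => ∫ ω, (OST.fracTransmitted (Q r) (Λ r) t ω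
                + OST.fracNontransmitted (Q r) (Λ r) t ω) ∂(OST.channelLaw (n r) (C r) (Q r)))
              atTop (𝓝 δ)) ∧
        (∀ t : ℝ,
            Tendsto (fun r => ∫ ω, (OST.fracTransmitted (Q r) (Λ r) t ω
                + OST.fracNontransmitted (Q r) (Λ r) t ω) ∂(OST.channelLaw (n r) (C r) (Q r)))
              atTop (𝓝 δ) →
          ∃ p : ℝ,
            Tendsto (fun r => ∫ ω, OST.fracTransmitted (Q r) (Λ r) t ω
                ∂(OST.channelLaw (n r) (C r) (Q r)))
              atTop (𝓝 ((1 - p) * δ)) ∧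
            (p < ε ↔ ρ < c δ ε) ∧ (p = ε ↔ ρ = c δ ε) ∧ (ε < p ↔ c δ ε < ρ))) := by
  refine ⟨fun n C Q Λ δ ρ hρ h t => ⟨h.tendsto_integral_fracTransmitted hρ t,
    h.tendsto_integral_fracNontransmitted hρ t⟩, OST.criticalLoad, fun δ ε hδ hε hδε =>
    ⟨OST.criticalLoad_pos hδ hε hδε, fun n C Q Λ ρ hρ h => ?_⟩⟩
  have hcmp {t : ℝ} (ht : OST.acceptedLimit δ ρ t = δ) :=
    OST.cmp_missed_criticalLoad hδ hε hδε hρ ht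
  have hunique := OST.existsUnique_acceptedLimit_eq hδ (by linarith) hρ
  simp only [h.tendsto_integral_fracTransmitted_iff hδ.ne' hρ,
    h.tendsto_integral_accepted_iff hρ, OST.tendsto_nhds_iff_eq h.load_tendsto]
  refine ⟨⟨?_, fun hc => ?_⟩, hunique, fun t ht => ⟨_, rfl, ?_, ?_, ?_⟩⟩
  · rintro ⟨t, hmissed, ht⟩
    exact (eq_iff_eq_of_cmp_eq_cmp (hcmp ht)).1 hmissed
  · obtain ⟨t, ht, -⟩ := hunique
    exact ⟨t, (eq_iff_eq_of_cmp_eq_cmp (hcmp ht)).2 hc, ht⟩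
  · exact lt_iff_lt_of_cmp_eq_cmp (hcmp ht)
  · exact eq_iff_eq_of_cmp_eq_cmp (hcmp ht)
  · exact lt_iff_lt_of_cmp_eq_cmp (cmp_eq_cmp_symm.1 (hcmp ht))
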